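/- Definitions. A $(0,1)$-matrix is *lonesum* if it is uniquely determined, among $(0,1)$-matrices of its size, by its row and column sum vectors. It is a *Ferrers matrix* if $a_{ij}=0$ implies $a_{lj}=0$ for all $l\ge i$ and $a_{il}=0$ for all $l\ge j$. Write $A\sim B$ if $A$ is obtained from $B$ by permutations of rows and of columns. A $(0,1)$-matrix $A$ is *lonesum decomposable* if $A\sim\operatorname{diag}(L_1,\dots,L_h)$ (block diagonal) with lonesum matrices $L_1,\dots,L_h$; it has *decomposition order* $k$ if $A\sim\operatorname{diag}(F_1,\dots,F_k,O)$, where $F_1,\dots,F_k$ are nonempty Ferrers matrices with no zero rows or zero columns and $O$ is a (possibly empty) zero matrix. For integers $k,m,n\ge 0$ let $D_k(m,n)$ be the number of $m\times n$ lonesum decomposable matrices of decomposition order $k$, where an $m\times 0$ or $0\times n$ matrix counts as one empty matrix of order $0$; thus $D_0(m,n)=1$ for all $m,n\ge 0$, and $D_k(m,0)=D_k(0,m)=0$ for $k\ge 1$, $m\ge 0$. For $r\ge 1$ and integers $k_1,\dots,k_r$ let $$\mathrm{Li}^{\star}_{k_1,\dots,k_r}(z)=\sum_{1\le m_1\le\cdots\le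 m_r}\frac{z^{m_r}}{m_1^{k_1}\cdots m_r^{k_r}},$$ and define the multi-poly-Bernoulli-star polynomials $B_{n,\star}^{(k_1,\dots,k_r)}(x)\in\mathbb{Q}[x]$ by the identity of formal power series $$e^{-xt}\,\frac{\mathrm{Li}^{\star}_{k_1,\dots,k_r}(1-e^{-t})}{1-e^{-t}}=\sum_{n=0}^{\infty}B_{n,\star}^{(k_1,\dots,k_r)}(x)\,\frac{t^n}{n!}.$$ Proposition 3.4. For all integers $k,m,n\ge 0$, $$D_k(m,n)=\frac{(-1)^k}{k!}\left(1+\sum_{i=1}^{k}\binom{k}{i}(-1)^i\,B_{n,\star}^{(\overbrace{\scriptstyle 0,\dots,0}^{i-1},\,-m)}(i-1)\right).$$ -/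

import Mathlib

/-! ### `(0,1)`-matrices, lonesum and lonesum decomposable matrices -/

/-- The `m × n` `(0,1)`-matrices. -/
abbrev ZeroOneMatrix (m n : ℕ) : Type := Matrix (Fin m) (Fin n) (Fin 2)

/-- The row sum vector (sums taken in `ℕ`). -/
def rowSums {m n : ℕ} (A : ZeroOneMatrix m n) : Fin m → ℕ := fun i => ∑ j, (A i j : ℕ)

/-- The column sum vector (sums taken in `ℕ`). -/
def colSums {m n : ℕ} (A : ZeroOneMatrix m n) : Fin n → ℕ := fun j => ∑ i, (A i j : ℕ)

/-- A `(0,1)`-matrix is lonesum if it is uniquely determined by its row and column sum vectors. -/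
def IsLonesum {m n : ℕ} (A : ZeroOneMatrix m n) : Prop :=
  ∀ B : ZeroOneMatrix m n, rowSums B = rowSums A → colSums B = colSums A → B = A

/-- Ferrers matrices: below a `0` and to the right of a `0` there are only `0`s. -/
def IsFerrers {m n : ℕ} (A : ZeroOneMatrix m n) : Prop :=
  (∀ i j, A i j = 0 → ∀ k, i ≤ k → A k j = 0) ∧ (∀ i j, A i j = 0 → ∀ l, j ≤ l → A i l = 0)

/-- No row and no column is zero. -/
def HasNoZeroRowOrCol {m n : ℕ} (A : ZeroOneMatrix m n) : Prop :=
  (∀ i, ∃ j, A i j ≠ 0) ∧ (∀ j, ∃ i, A i j ≠ 0)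

/-- `A` is, up to permutations of rows and columns, the block diagonal matrix
`diag(L₁, …, L_k)` with lonesum blocks `L_i` of size `p i × q i`. The bijections `e` and `f`
combine the row and column permutations with the numbering of the rows and columns of the
block diagonal matrix. -/
def IsLonesumDecomposable {m n : ℕ} (A : ZeroOneMatrix m n) : Prop :=
  ∃ (k : ℕ) (p q : Fin k → ℕ) (L : ∀ i, ZeroOneMatrix (p i) (q i))
    (e : Fin m ≃ Σ i, Fin (p i)) (f : Fin n ≃ Σ i, Fin (q i)),
    (∀ i, IsLonesum (L i)) ∧ A = (Matrix.blockDiagonal' L).submatrix e f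

/-- `A` is, up to permutations of rows and columns, `diag(F₁, …, F_k, O)`, where the `F_i` are
(nonempty) Ferrers matrices without zero rows or zero columns and `O` is an `r × s` zero matrix
(`r = 0` or `s = 0` is allowed). -/
def HasDecompositionOrder {m n : ℕ} (A : ZeroOneMatrix m n) (k : ℕ) : Prop :=
  ∃ (p q : Fin k → ℕ) (r s : ℕ) (F : ∀ i, ZeroOneMatrix (p i) (q i))
    (e : Fin m ≃ (Σ i, Fin (p i)) ⊕ Fin r) (f : Fin n ≃ (Σ i, Fin (q i)) ⊕ Fin s),
    (∀ i, 0 < p i ∧ 0 < q i) ∧ (∀ i, IsFerrers (F i) ∧ HasNoZeroRowOrCol (F i)) ∧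
    A = (Matrix.fromBlocks (Matrix.blockDiagonal' F) 0 0 0).submatrix e f

/-- `D_k(m,n)`: the number of `m × n` lonesum decomposable matrices of decomposition order `k`.
An `m × 0` or `0 × n` matrix counts as one (empty) matrix of order `0`; so
`D_k(m,0) = D_k(0,n) = 0` for `k ≥ 1`, and `D_0(m,n) = 1` (only the zero matrix has order `0`). -/
noncomputable def lonesumD (k m n : ℕ) : ℕ :=
  Nat.card {A : ZeroOneMatrix m n // IsLonesumDecomposable A ∧ HasDecompositionOrder A k}

/-! ### Multi-poly-Bernoulli-star polynomials

An index `(k₁, …, k_{r+1})` of positive length is a function `κ : Fin (r + 1) → ℤ`. -/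

open Classical in
/-- The coefficient of `z ^ N` in the star multiple polylogarithm:
the sum of `1 / (m₁ ^ k₁ ⋯ m_{r+1} ^ k_{r+1})` over `1 ≤ m₁ ≤ ⋯ ≤ m_{r+1} = N`. -/
noncomputable def liStarCoeff {r : ℕ} (κ : Fin (r + 1) → ℤ) (N : ℕ) : ℚ :=
  ∑ μ ∈ (Fintype.piFinset fun _ : Fin (r + 1) => Finset.Icc 1 N).filter
      (fun μ => Monotone μ ∧ μ (Fin.last r) = N),
    1 / ∏ a, (μ a : ℚ) ^ κ a

/-- The star multiple polylogarithm `Li^⋆_κ(z)` as a formal power series. -/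
noncomputable def liStar {r : ℕ} (κ : Fin (r + 1) → ℤ) : PowerSeries ℚ :=
  PowerSeries.mk (liStarCoeff κ)

/-- The power series `Li^⋆_κ(z) / z`. -/
noncomputable def liStarDivZ {r : ℕ} (κ : Fin (r + 1) → ℤ) : PowerSeries ℚ :=
  PowerSeries.mk fun N => liStarCoeff κ (N + 1)

/-- The power series `1 - e^{-t}`. -/
noncomputable def oneSubExpNeg : PowerSeries ℚ :=
  1 - PowerSeries.rescale (-1 : ℚ) (PowerSeries.exp ℚ)

/-- The power series `Li^⋆_κ(1 - e^{-t}) / (1 - e^{-t})`; see `oneSubExpNeg_mul_liStarQuot`. -/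
noncomputable def liStarQuot {r : ℕ} (κ : Fin (r + 1) → ℤ) : PowerSeries ℚ :=
  (liStarDivZ κ).subst oneSubExpNeg

theorem hasSubst_oneSubExpNeg : PowerSeries.HasSubst oneSubExpNeg := by
  apply PowerSeries.HasSubst.of_constantCoeff_zero'
  rw [← PowerSeries.coeff_zero_eq_constantCoeff_apply, oneSubExpNeg, map_sub,
    PowerSeries.coeff_rescale, PowerSeries.coeff_exp]
  simp

theorem liStar_eq {r : ℕ} (κ : Fin (r + 1) → ℤ) : liStar κ = PowerSeries.X * liStarDivZ κ := by
  ext N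
  cases N with
  | zero => simp [liStar, liStarCoeff]
  | succ N => simp [liStar, liStarDivZ, PowerSeries.coeff_succ_X_mul]

/-- `liStarQuot κ` is the quotient of `Li^⋆_κ(1 - e^{-t})` by the nonzero series `1 - e^{-t}`. -/
theorem oneSubExpNeg_mul_liStarQuot {r : ℕ} (κ : Fin (r + 1) → ℤ) :
    oneSubExpNeg * liStarQuot κ = (liStar κ).subst oneSubExpNeg := by
  rw [liStar_eq, PowerSeries.subst_mul hasSubst_oneSubExpNeg,
    PowerSeries.subst_X hasSubst_oneSubExpNeg, liStarQuot]

open Polynomial in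
/-- The multi-poly-Bernoulli-star polynomial `B_{n,⋆}^{κ}(x)`, defined by
`e^{-xt} Li^⋆_κ(1 - e^{-t}) / (1 - e^{-t}) = ∑ₙ B_{n,⋆}^{κ}(x) tⁿ / n!` in `ℚ[x][[t]]`. -/
noncomputable def multiPolyBernoulliStar {r : ℕ} (κ : Fin (r + 1) → ℤ) (n : ℕ) : ℚ[X] :=
  (n.factorial : ℚ[X]) *
    PowerSeries.coeff n
      (PowerSeries.rescale (-X : ℚ[X]) (PowerSeries.exp ℚ[X]) *
        PowerSeries.map (C : ℚ →+* ℚ[X]) (liStarQuot κ))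

/-- The index `(0, …, 0, -m)` with `z` leading zeros. -/
def zerosThenNeg (z m : ℕ) : Fin (z + 1) → ℤ :=
  Fin.snoc (α := fun _ => ℤ) (fun _ => 0) (-(m : ℤ))

/-! Both sides are expressed through h(j,n) = `hitCount j n`, whose exponential generating function
in n is e^t(e^t - 1)^j.

Analytic side: the coefficient of z^N in Li*(z)/z for the index (0,…,0,-m) with d zeros is (N+1)^m
C(N+d,d). Expanding (N+1)^m in the binomials C(N,j) gives Li*(z)/z = ∑_j h(j,m) C(d+j,d)
z^j/(1-z)^(d+j+1). At z = 1 - e^(-t) one has 1/(1-z) = e^t, so multiplication by e^(-dt) leaves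
e^t(e^t - 1)^j. Hence the value at x = d is ∑_j C(d+j,d) h(j,m) h(j,n)
(`eval_multiPolyBernoulliStar_zerosThenNeg`).

Combinatorial side: a matrix of order k has k blocks with nested rows, and they can be named in
exactly k! ways. If block i has s_i distinct rows, these form a chain of levels. Every column of the
block starts at one level, and every level is used by some row and some column. So the matrix with
named blocks is a pair of maps hitting all |s| = ∑ s_i levels, with `none` for zero rows and
columns. This gives k! D_k = ∑_s h(|s|,m) h(|s|,n) (`card_isChainLabeling`,
`lonesumD_mul_factorial`).

Link: C(d+j,d) is the coefficient of z^j in (1-z)^(-(d+1)). The alternating sum over i is thus, up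
to the sign (-1)^k, the expansion of (1/(1-z) - 1)^k, whose coefficients count the compositions s of
j into k positive parts. -/

open Finset

/-! ### Counting maps that hit all levels -/

/-- The function `f` attains every value different from `none`. -/
def HitsAll {α β : Type*} (f : α → Option β) : Prop := ∀ b, ∃ x, f x = some b

/-- The number of maps from an `n`-element set to `{none} ∪ {1, …, j}` attaining every value
different from `none`. -/
noncomputable def hitCount (j n : ℕ) : ℕ := Nat.card {f : Fin n → Option (Fin j) // HitsAll f}

theorem card_hitsAll (α β : Type*) [Finite α] [Finite β] :
    Nat.card {f : α → Option β // HitsAll f} = hitCount (Nat.card β) (Nat.card α) := by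
  let e := Finite.equivFin α
  let g := Finite.equivFin β
  refine Nat.card_congr ((Equiv.arrowCongr e (Equiv.optionCongr g)).subtypeEquiv fun f => ?_)
  constructor
  · intro h b
    obtain ⟨x, hx⟩ := h (g.symm b)
    exact ⟨e x, by simp [hx]⟩
  · intro h b
    obtain ⟨x, hx⟩ := h (g b)
    refine ⟨e.symm x, ?_⟩
    have := congrArg (Equiv.optionCongr g).symm hx
    simpa using this

theorem hitCount_eq_zero {j n : ℕ} (h : n < j) : hitCount j n = 0 := by
  rw [hitCount, Nat.card_eq_zero]
  left
  refine ⟨fun ⟨f, hf⟩ => ?_⟩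
  choose g hg using hf
  have hinj : Function.Injective g := fun a b hab => by
    have := (hg a).symm.trans ((congrArg f hab).trans (hg b))
    simpa using this
  have := Fintype.card_le_of_injective g hinj
  simp at this
  omega

/-- Maps attaining exactly the values in `S` and possibly `none`, seen as maps to `Option S`. -/
theorem card_image_eq_hitCount {n N : ℕ} (S : Finset (Fin N)) :
    Nat.card {f : Fin n → Option (Fin N) // ∀ b, (∃ x, f x = some b) ↔ b ∈ S} =
      hitCount #S n := by
  have := card_hitsAll (Fin n) S
  rw [Nat.card_eq_fintype_card (α := S), Nat.card_eq_fintype_card (α := Fin n), Fintype.card_coe,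
    Fintype.card_fin] at this
  rw [← this]
  symm
  refine Nat.card_congr (Equiv.ofBijective
    (fun f => ⟨fun x => (f.1 x).map Subtype.val, fun b => ⟨?_, ?_⟩⟩) ⟨?_, ?_⟩)
  · rintro ⟨x, hx⟩
    simp only [Option.map_eq_some_iff] at hx
    obtain ⟨a, -, rfl⟩ := hx
    exact a.2
  · intro hb
    obtain ⟨x, hx⟩ := f.2 ⟨b, hb⟩
    exact ⟨x, by simp [hx]⟩
  · intro f g h
    apply Subtype.ext
    funext x
    exact Option.map_injective Subtype.val_injective (congrFun (congrArg Subtype.val h) x)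
  · rintro ⟨f, hf⟩
    refine ⟨⟨fun x => (f x).pmap (fun b hb => ⟨b, hb⟩) fun b hb => (hf b).1 ⟨x, hb⟩, ?_⟩, ?_⟩
    · rintro ⟨b, hb⟩
      obtain ⟨x, hx⟩ := (hf b).2 hb
      exact ⟨x, by simp [hx]⟩
    · apply Subtype.ext
      funext x
      simp [Option.map_pmap]

/-- All maps from `Fin n` to `Option (Fin N)` are sorted by the set of values other than `none` that
they attain. -/
theorem succ_pow_eq_sum_hitCount (N n : ℕ) :
    (N + 1) ^ n = ∑ j ∈ range (N + 1), N.choose j * hitCount j n := by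
  classical
  have h1 : (N + 1) ^ n = Fintype.card (Fin n → Option (Fin N)) := by simp
  let T : (Fin n → Option (Fin N)) → Finset (Fin N) := fun f => {b | ∃ x, f x = some b}
  rw [h1, ← Finset.card_univ, Finset.card_eq_sum_card_fiberwise (f := T) (t := univ) (by simp)]
  have h2 : ∀ S : Finset (Fin N), #{f | T f = S} = hitCount #S n := fun S => by
    rw [← card_image_eq_hitCount, ← Fintype.card_subtype, ← Nat.card_eq_fintype_card]
    refine Nat.card_congr (Equiv.subtypeEquivRight fun f => ?_)
    simp [T, Finset.ext_iff]
  rw [Finset.sum_congr rfl fun S _ => h2 S, ← Finset.powerset_univ,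
    Finset.sum_powerset_apply_card (fun j => hitCount j n)]
  simp

/-- Terms with j > N or j > n vanish. A range independent of N is what turns this into an identity
of power series in `liStarDivZ_zerosThenNeg`. -/
theorem succ_pow_eq_sum_hitCount' (N n : ℕ) :
    (N + 1) ^ n = ∑ j ∈ range (n + 1), N.choose j * hitCount j n := by
  rw [succ_pow_eq_sum_hitCount]
  rcases le_total N n with h | h
  · refine Finset.sum_subset (by simpa using h) fun j _ hj => ?_
    rw [Nat.choose_eq_zero_of_lt (by simpa using hj), zero_mul]
  · refine (Finset.sum_subset (by simpa using h) fun j _ hj => ?_).symm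
    rw [hitCount_eq_zero (by simpa using hj), mul_zero]

open PowerSeries

/-- Expanding e^((j+1)t) = e^t((e^t - 1) + 1)^j gives the right side the same triangular recurrence
as `succ_pow_eq_sum_hitCount`; its diagonal coefficients are 1, so strong induction applies. -/
theorem hitCount_eq_coeff (j n : ℕ) :
    (hitCount j n : ℚ) = n.factorial * coeff n (exp ℚ * (exp ℚ - 1) ^ j) := by
  induction j using Nat.strong_induction_on with
  | _ j ih =>
    have h : ((j : ℚ) + 1) ^ n =
        ∑ l ∈ range (j + 1), (j.choose l : ℚ) * (n.factorial * coeff n (exp ℚ * (exp ℚ - 1) ^ l)) := by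
      have h1 : rescale ((j + 1 : ℕ) : ℚ) (exp ℚ) =
          ∑ l ∈ range (j + 1), PowerSeries.C (j.choose l : ℚ) * (exp ℚ * (exp ℚ - 1) ^ l) := by
        rw [← exp_pow_eq_rescale_exp, pow_succ]
        nth_rw 1 [← sub_add_cancel (exp ℚ) 1]
        rw [add_pow, Finset.sum_mul]
        refine Finset.sum_congr rfl fun l _ => ?_
        rw [one_pow, map_natCast]
        ring
      have h2 := congrArg (coeff n) h1
      rw [coeff_rescale, coeff_exp, map_sum] at h2
      simp only [coeff_C_mul] at h2
      have hn : (n.factorial : ℚ) ≠ 0 := by positivity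
      have h3 : ((j : ℚ) + 1) ^ n = n.factorial * (((j + 1 : ℕ) : ℚ) ^ n *
          algebraMap ℚ ℚ (1 / n.factorial)) := by
        push_cast
        field_simp
      rw [h3, h2, Finset.mul_sum]
      exact Finset.sum_congr rfl fun l _ => by ring
    have h' := congrArg (Nat.cast (R := ℚ)) (succ_pow_eq_sum_hitCount j n)
    push_cast at h'
    rw [h', Finset.sum_range_succ, Finset.sum_range_succ,
      Finset.sum_congr rfl fun l hl => by rw [ih l (by simpa using hl)]] at h
    simpa using h

/-! ### Star multiple polylogarithms -/

/-- The last summation index is N itself; M is the value of the one before it. -/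
theorem liStarCoeff_snoc {r : ℕ} (κ : Fin (r + 1) → ℤ) (c : ℤ) (N : ℕ) :
    liStarCoeff (Fin.snoc (α := fun _ => ℤ) κ c : Fin (r + 1 + 1) → ℤ) N =
      (∑ M ∈ Icc 1 N, liStarCoeff κ M) / (N : ℚ) ^ c := by
  classical
  unfold liStarCoeff
  rw [Finset.sum_div, Finset.sum_congr rfl fun M _ => Finset.sum_div _ _ _, Finset.sum_sigma']
  refine Finset.sum_bij' (fun μ _ => ⟨μ (Fin.last r).castSucc, Fin.init μ⟩)
    (fun x _ => Fin.snoc (α := fun _ => ℕ) x.2 N) ?_ ?_ ?_ ?_ ?_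
  · intro μ hμ
    simp only [mem_filter, Fintype.mem_piFinset, mem_Icc, mem_sigma] at hμ ⊢
    obtain ⟨h1, h2, -⟩ := hμ
    refine ⟨h1 _, fun a => ⟨(h1 _).1, h2 ?_⟩, fun a b hab => h2 ?_, rfl⟩
    · exact Fin.castSucc_le_castSucc_iff.2 (Fin.le_last a)
    · exact Fin.castSucc_le_castSucc_iff.2 hab
  · rintro ⟨M, ν⟩ hν
    simp only [mem_filter, Fintype.mem_piFinset, mem_Icc, mem_sigma] at hν ⊢
    obtain ⟨⟨h1, h2⟩, h3, h4, h5⟩ := hν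
    refine ⟨?_, ?_, by simp⟩
    · refine Fin.lastCases ?_ fun a => ?_
      · simp; omega
      · have := h3 a
        simp; omega
    · refine Fin.monotone_iff_le_succ.2 (Fin.lastCases ?_ fun a => ?_)
      · rw [Fin.succ_last, Fin.snoc_last, Fin.snoc_castSucc, h5]
        exact h2
      · rw [Fin.succ_castSucc, Fin.snoc_castSucc, Fin.snoc_castSucc]
        exact Fin.monotone_iff_le_succ.1 h4 a
  · intro μ hμ
    simp only [mem_filter] at hμ
    rw [← hμ.2.2]
    exact Fin.snoc_init_self μ
  · rintro ⟨M, ν⟩ hν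
    simp only [mem_filter, mem_sigma] at hν
    rw [Sigma.mk.injEq]
    refine ⟨?_, ?_⟩
    · rw [Fin.snoc_castSucc]
      exact hν.2.2.2
    · exact heq_of_eq (Fin.init_snoc _ _)
  · intro μ hμ
    simp only [mem_filter] at hμ
    rw [Fin.prod_univ_castSucc, Fin.snoc_last, hμ.2.2, div_div]
    simp only [Fin.snoc_castSucc, Fin.init]

theorem liStarCoeff_one (κ : Fin 1 → ℤ) (N : ℕ) :
    liStarCoeff κ (N + 1) = 1 / ((N : ℚ) + 1) ^ κ 0 := by
  classical
  rw [liStarCoeff, Finset.sum_eq_single_of_mem (fun _ => N + 1)]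
  · simp
  · simp [monotone_const]
  · intro μ hμ h
    refine absurd (funext fun a => ?_) h
    rw [show a = Fin.last 0 from Subsingleton.elim (α := Fin 1) _ _]
    exact (mem_filter.1 hμ).2.2

theorem sum_Icc_one_eq (f : ℕ → ℚ) (N : ℕ) :
    ∑ M ∈ Icc 1 N, f M = ∑ M ∈ range N, f (M + 1) := by
  rw [Finset.range_eq_Ico, Finset.sum_Ico_add' f 0 N 1]
  rfl

theorem liStarCoeff_zeros (r N : ℕ) :
    liStarCoeff (fun _ : Fin (r + 1) => 0) (N + 1) = ((N + r).choose r : ℚ) := by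
  induction r generalizing N with
  | zero => rw [liStarCoeff_one]; simp
  | succ r ih =>
    have h : (fun _ : Fin (r + 1 + 1) => (0 : ℤ)) =
        Fin.snoc (α := fun _ => ℤ) (fun _ : Fin (r + 1) => 0) 0 := by
      funext a
      refine Fin.lastCases ?_ (fun a => ?_) a <;> simp
    rw [h, liStarCoeff_snoc, zpow_zero, div_one, sum_Icc_one_eq,
      Finset.sum_congr rfl fun M _ => ih M, ← Nat.cast_sum,
      Nat.sum_range_add_choose, add_assoc]

theorem liStarCoeff_zerosThenNeg (d m N : ℕ) :
    liStarCoeff (zerosThenNeg d m) (N + 1) = ((N + 1 : ℚ)) ^ m * ((N + d).choose d : ℚ) := by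
  cases d with
  | zero =>
    have : zerosThenNeg 0 m 0 = -(m : ℤ) := Fin.snoc_last (α := fun _ => ℤ) _ _
    rw [liStarCoeff_one, this]
    simp
  | succ d =>
    rw [zerosThenNeg, liStarCoeff_snoc, sum_Icc_one_eq,
      Finset.sum_congr rfl fun M _ => liStarCoeff_zeros d M, ← Nat.cast_sum,
      Nat.sum_range_add_choose, add_assoc, zpow_neg, zpow_natCast, div_inv_eq_mul, mul_comm]
    push_cast
    rfl

theorem coeff_X_pow_mul_mk_one_pow (j d N : ℕ) :
    coeff N (X ^ j * (mk 1 : PowerSeries ℚ) ^ (d + j + 1)) = ((N + d).choose (d + j) : ℚ) := by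
  rw [mk_one_pow_eq_mk_choose_add, coeff_X_pow_mul']
  split_ifs with h
  · rw [coeff_mk]
    congr 2
    omega
  · rw [Nat.choose_eq_zero_of_lt (by omega), Nat.cast_zero]

/-- After (N+1)^m is expanded, C(N,j) C(N+d,d) = C(N+d,d+j) C(d+j,d) separates the dependence on N,
which is the coefficient of z^j/(1-z)^(d+j+1). -/
theorem liStarDivZ_zerosThenNeg (d m : ℕ) :
    liStarDivZ (zerosThenNeg d m) = ∑ j ∈ range (m + 1),
      ((hitCount j m * (d + j).choose d : ℕ) : ℚ) • (X ^ j * (mk 1 : PowerSeries ℚ) ^ (d + j + 1)) := by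
  ext N
  rw [liStarDivZ, coeff_mk, liStarCoeff_zerosThenNeg, map_sum]
  have h := congrArg (Nat.cast (R := ℚ)) (succ_pow_eq_sum_hitCount' N m)
  push_cast at h
  rw [h, Finset.sum_mul]
  refine Finset.sum_congr rfl fun j _ => ?_
  rw [coeff_smul, coeff_X_pow_mul_mk_one_pow, smul_eq_mul]
  norm_cast
  have h2 : (N + d).choose (d + j) * (d + j).choose d = (N + d).choose d * N.choose j := by
    rcases le_or_gt j N with hj | hj
    · rw [Nat.choose_mul (by omega)]
      congr 2 <;> omega
    · rw [Nat.choose_eq_zero_of_lt (show N + d < d + j by omega), Nat.choose_eq_zero_of_lt hj]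
      simp
  linear_combination (hitCount j m) * h2.symm

/-! ### Substituting 1 - e^(-t) -/

theorem exp_mul_rescale_neg_one : exp ℚ * rescale (-1 : ℚ) (exp ℚ) = 1 := exp_mul_exp_neg_eq_one

theorem subst_mk_one : (mk 1 : PowerSeries ℚ).subst oneSubExpNeg = exp ℚ := by
  have h := congrArg (PowerSeries.subst oneSubExpNeg) (mk_one_mul_one_sub_eq_one ℚ)
  rw [subst_mul hasSubst_oneSubExpNeg, subst_sub hasSubst_oneSubExpNeg,
    subst_X hasSubst_oneSubExpNeg, ← coe_substAlgHom hasSubst_oneSubExpNeg, map_one] at h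
  rw [← coe_substAlgHom hasSubst_oneSubExpNeg]
  have e := exp_mul_rescale_neg_one
  have h0 : 1 - oneSubExpNeg = rescale (-1 : ℚ) (exp ℚ) := sub_sub_cancel _ _
  rw [h0] at h
  linear_combination (exp ℚ) * h - (substAlgHom hasSubst_oneSubExpNeg (mk 1 : PowerSeries ℚ)) * e

theorem liStarQuot_zerosThenNeg (d m : ℕ) :
    liStarQuot (zerosThenNeg d m) = ∑ j ∈ range (m + 1),
      ((hitCount j m * (d + j).choose d : ℕ) : ℚ) • (oneSubExpNeg ^ j * (exp ℚ) ^ (d + j + 1)) := by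
  have h1 := subst_mk_one
  have h2 : (X : PowerSeries ℚ).subst oneSubExpNeg = oneSubExpNeg :=
    subst_X hasSubst_oneSubExpNeg
  rw [← coe_substAlgHom hasSubst_oneSubExpNeg] at h1 h2
  rw [liStarQuot, liStarDivZ_zerosThenNeg, ← coe_substAlgHom hasSubst_oneSubExpNeg, map_sum]
  refine Finset.sum_congr rfl fun j _ => ?_
  rw [map_smul, map_mul, map_pow, map_pow, h1, h2]

theorem eval_multiPolyBernoulliStar {r : ℕ} (κ : Fin (r + 1) → ℤ) (n : ℕ) (x : ℚ) :
    (multiPolyBernoulliStar κ n).eval x =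
      n.factorial * coeff n (rescale (-x) (exp ℚ) * liStarQuot κ) := by
  rw [multiPolyBernoulliStar, Polynomial.eval_mul, Polynomial.eval_natCast,
    ← Polynomial.coe_evalRingHom, ← coeff_map, map_mul]
  congr 3
  · ext l
    simp [coeff_rescale, coeff_exp]
  · ext l
    simp

theorem rescale_neg_natCast_exp (d : ℕ) :
    rescale (-(d : ℚ)) (exp ℚ) = (rescale (-1 : ℚ) (exp ℚ)) ^ d := by
  rw [← map_pow, exp_pow_eq_rescale_exp, rescale_rescale]
  congr 2
  ring

theorem eval_multiPolyBernoulliStar_zerosThenNeg (d m n : ℕ) :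
    (multiPolyBernoulliStar (zerosThenNeg d m) n).eval (d : ℚ) =
      ∑ j ∈ range (m + 1), ((d + j).choose d : ℚ) * (hitCount j m * hitCount j n) := by
  rw [eval_multiPolyBernoulliStar, liStarQuot_zerosThenNeg, Finset.mul_sum, map_sum,
    Finset.mul_sum]
  refine Finset.sum_congr rfl fun j _ => ?_
  rw [hitCount_eq_coeff j n, mul_smul_comm, coeff_smul, rescale_neg_natCast_exp, oneSubExpNeg]
  have e := exp_mul_rescale_neg_one
  set y := rescale (-1 : ℚ) (exp ℚ)
  -- Evaluation at x = d is chosen so that e^(-dt) cancels the d-dependent power of e^t.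
  have h : y ^ d * ((1 - y) ^ j * exp ℚ ^ (d + j + 1)) = exp ℚ * (exp ℚ - 1) ^ j := by
    have h1 : (exp ℚ - 1) ^ j = (exp ℚ) ^ j * (1 - y) ^ j := by
      rw [← mul_pow, mul_sub, e, mul_one]
    have h2 : y ^ d * (exp ℚ) ^ d = 1 := by rw [← mul_pow, mul_comm, e, one_pow]
    rw [h1, pow_succ, pow_add]
    linear_combination (1 - y) ^ j * exp ℚ ^ j * exp ℚ * h2
  rw [h, smul_eq_mul]
  push_cast
  ring

/-! ### Chain labelings of relations -/

/-- The labels `R`, `C` of the rows and columns of the relation `A` split `A` into blocks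
(one for each label) without zero rows or zero columns, in which the rows are nested. -/
structure IsChainLabeling {α β κ : Type*} (A : α → β → Prop) (R : α → Option κ)
    (C : β → Option κ) : Prop where
  comp : ∀ r c, A r c → R r = C c
  row : ∀ r, R r ≠ none ↔ ∃ c, A r c
  col : ∀ c, C c ≠ none ↔ ∃ r, A r c
  surj : ∀ i, ∃ r, R r = some i
  nested : ∀ r r', R r = R r' → (∀ c, A r c → A r' c) ∨ (∀ c, A r' c → A r c)

namespace IsChainLabeling

variable {α β κ : Type*} {A : α → β → Prop} {R R' : α → Option κ} {C C' : β → Option κ}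

/-- Two incomparable columns of one block would yield two rows of that block that are incomparable
as well. -/
theorem swap (h : IsChainLabeling A R C) : IsChainLabeling (fun c r => A r c) C R where
  comp c r hA := (h.comp r c hA).symm
  row := h.col
  col := h.row
  surj i := by
    obtain ⟨r, hr⟩ := h.surj i
    obtain ⟨c, hc⟩ := (h.row r).1 (by simp [hr])
    exact ⟨c, (h.comp r c hc).symm.trans hr⟩
  nested c c' hcc := by
    by_contra! hcon
    obtain ⟨⟨r, h1, h2⟩, r', h3, h4⟩ := hcon
    have hr : R r = R r' := (h.comp r c h1).trans (hcc.trans (h.comp r' c' h3).symm)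
    rcases h.nested r r' hr with hs | hs
    · exact h4 (hs c h1)
    · exact h2 (hs c' h3)

theorem relabel (h : IsChainLabeling A R C) (σ : Equiv.Perm κ) :
    IsChainLabeling A (fun r => (R r).map σ) (fun c => (C c).map σ) where
  comp r c hA := congrArg (Option.map σ) (h.comp r c hA)
  row r := by simpa using h.row r
  col c := by simpa using h.col c
  surj i := by
    obtain ⟨r, hr⟩ := h.surj (σ.symm i)
    exact ⟨r, by simp [hr]⟩
  nested r r' hr := h.nested r r' (Option.map_injective σ.injective hr)

/-- The relation alone determines the blocks: nested nonzero rows share a column, and that column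
forces equal labels in any other labeling. -/
theorem row_eq_of_row_eq (h : IsChainLabeling A R C) (h' : IsChainLabeling A R' C')
    {r₁ r₂ : α} (hr : R r₁ = R r₂) : R' r₁ = R' r₂ := by
  by_cases h0 : R r₁ = none
  · have e1 : R' r₁ = none := by
      by_contra hc
      exact (h.row r₁).2 ((h'.row r₁).1 hc) h0
    have e2 : R' r₂ = none := by
      by_contra hc
      exact (h.row r₂).2 ((h'.row r₂).1 hc) (hr ▸ h0)
    rw [e1, e2]
  · rcases h.nested r₁ r₂ hr with hs | hs
    · obtain ⟨c, hc⟩ := (h.row r₁).1 h0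
      rw [h'.comp _ _ hc, h'.comp _ _ (hs c hc)]
    · obtain ⟨c, hc⟩ := (h.row r₂).1 (hr ▸ h0)
      rw [h'.comp _ _ hc, h'.comp _ _ (hs c hc)]

theorem exists_map (h : IsChainLabeling A R C) (h' : IsChainLabeling A R' C') :
    ∃ σ : κ → κ, (∀ r, R' r = (R r).map σ) ∧ ∀ c, C' c = (C c).map σ := by
  choose g hg using h.surj
  have h1 : ∀ i, ∃ j, R' (g i) = some j := fun i =>
    Option.ne_none_iff_exists'.1 ((h'.row _).2 ((h.row _).1 (by simp [hg])))
  choose σ hσ using h1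
  have hR : ∀ r, R' r = (R r).map σ := fun r => by
    rcases hr : R r with _ | i
    · by_contra hc
      exact (h.row r).2 ((h'.row r).1 hc) hr
    · rw [h.row_eq_of_row_eq h' (hr.trans (hg i).symm), hσ]
      rfl
  refine ⟨σ, hR, fun c => ?_⟩
  rcases hc : C c with _ | i
  · by_contra hc'
    exact (h.col c).2 ((h'.col c).1 hc') hc
  · obtain ⟨r, hr⟩ := (h.col c).1 (by simp [hc])
    rw [← h'.comp r c hr, hR, h.comp r c hr, hc]

theorem eq_id_of_map (h : IsChainLabeling A R C) {σ : κ → κ} (hσ : ∀ r, R r = (R r).map σ) (i : κ) :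
    σ i = i := by
  obtain ⟨r, hr⟩ := h.surj i
  have := hσ r
  rw [hr] at this
  simpa using this.symm

/-- Permutations of the block names act simply transitively on the labelings of a fixed relation.
This is the source of the factor k!. -/
theorem nonempty_perm_equiv (h : IsChainLabeling A R C) : Nonempty (Equiv.Perm κ ≃
    {P : (α → Option κ) × (β → Option κ) // IsChainLabeling A P.1 P.2}) := by
  refine ⟨Equiv.ofBijective (fun σ => ⟨(_, _), h.relabel σ⟩) ⟨fun σ τ hst => ?_, ?_⟩⟩
  · ext i
    obtain ⟨r, hr⟩ := h.surj i
    have := congrFun (congrArg (fun P => P.1.1) hst) r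
    simpa [hr] using this
  · rintro ⟨⟨R', C'⟩, h'⟩
    obtain ⟨σ, h1, h2⟩ := h.exists_map h'
    obtain ⟨τ, h3, h4⟩ := h'.exists_map h
    have hl : ∀ i, τ (σ i) = i := h.eq_id_of_map (σ := τ ∘ σ) fun r => by
      rw [← Option.map_map, ← h1, ← h3]
    have hr : ∀ i, σ (τ i) = i := h'.eq_id_of_map (σ := σ ∘ τ) fun r => by
      rw [← Option.map_map, ← h3, ← h1]
    exact ⟨⟨σ, τ, hl, hr⟩, Subtype.ext (Prod.ext (funext fun r => (h1 r).symm)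
      (funext fun c => (h2 c).symm))⟩

end IsChainLabeling

/-! ### Levels in the blocks of a chain labeling -/

section Levels

variable {α β κ : Type*}

/-- The relation with row levels `ρ` and column levels `γ`: a row and a column of the same block
are related if and only if the level of the column is at most the level of the row. -/
def levelRel {s : κ → ℕ} (ρ : α → Option (Σ i, Fin (s i))) (γ : β → Option (Σ i, Fin (s i)))
    (r : α) (c : β) : Prop :=
  ∃ i, ∃ a b : Fin (s i), ρ r = some ⟨i, a⟩ ∧ γ c = some ⟨i, b⟩ ∧ b ≤ a

theorem levelRel_iff {s : κ → ℕ} {ρ : α → Option (Σ i, Fin (s i))}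
    {γ : β → Option (Σ i, Fin (s i))} {r : α} {c : β} {i : κ} {a b : Fin (s i)}
    (hr : ρ r = some ⟨i, a⟩) (hc : γ c = some ⟨i, b⟩) : levelRel ρ γ r c ↔ b ≤ a := by
  constructor
  · rintro ⟨j, a', b', hr', hc', hab⟩
    rw [hr] at hr'
    rw [hc] at hc'
    cases hr'
    cases hc'
    exact hab
  · exact fun h => ⟨i, a, b, hr, hc, h⟩

/-- The block label of a row or column with given levels. -/
def blockLabel {s : κ → ℕ} (ρ : α → Option (Σ i, Fin (s i))) (r : α) : Option κ :=
  (ρ r).map Sigma.fst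

theorem blockLabel_eq_some {s : κ → ℕ} {ρ : α → Option (Σ i, Fin (s i))} {r : α} {i : κ} :
    blockLabel ρ r = some i ↔ ∃ a, ρ r = some ⟨i, a⟩ := by
  simp only [blockLabel, Option.map_eq_some_iff]
  constructor
  · rintro ⟨⟨j, a⟩, h, rfl⟩
    exact ⟨a, h⟩
  · rintro ⟨a, h⟩
    exact ⟨_, h, rfl⟩

theorem blockLabel_eq_none {s : κ → ℕ} {ρ : α → Option (Σ i, Fin (s i))} {r : α} :
    blockLabel ρ r = none ↔ ρ r = none := by
  simp [blockLabel]

theorem isChainLabeling_levelRel {s : κ → ℕ} (hs : ∀ i, 0 < s i)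
    {ρ : α → Option (Σ i, Fin (s i))} {γ : β → Option (Σ i, Fin (s i))}
    (hρ : HitsAll ρ) (hγ : HitsAll γ) :
    IsChainLabeling (levelRel ρ γ) (blockLabel ρ) (blockLabel γ) where
  comp r c h := by
    obtain ⟨i, a, b, h1, h2, -⟩ := h
    simp [blockLabel, h1, h2]
  row r := by
    rw [Ne, blockLabel_eq_none]
    constructor
    · intro h
      obtain ⟨⟨i, a⟩, h⟩ := Option.ne_none_iff_exists'.1 h
      obtain ⟨c, hc⟩ := hγ ⟨i, a⟩
      exact ⟨c, i, a, a, h, hc, le_rfl⟩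
    · rintro ⟨c, i, a, b, h, -, -⟩
      simp [h]
  col c := by
    rw [Ne, blockLabel_eq_none]
    constructor
    · intro h
      obtain ⟨⟨i, a⟩, h⟩ := Option.ne_none_iff_exists'.1 h
      obtain ⟨r, hr⟩ := hρ ⟨i, a⟩
      exact ⟨r, i, a, a, hr, h, le_rfl⟩
    · rintro ⟨r, i, a, b, -, h, -⟩
      simp [h]
  surj i := by
    obtain ⟨r, hr⟩ := hρ ⟨i, ⟨0, hs i⟩⟩
    exact ⟨r, blockLabel_eq_some.2 ⟨_, hr⟩⟩
  nested r r' h := by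
    rcases hl : blockLabel ρ r with _ | i
    · left
      rintro c ⟨i, a, b, h1, -⟩
      rw [blockLabel_eq_none.1 hl] at h1
      cases h1
    · obtain ⟨a, ha⟩ := blockLabel_eq_some.1 hl
      obtain ⟨a', ha'⟩ := blockLabel_eq_some.1 (h ▸ hl)
      rcases le_total a a' with hle | hle
      · left
        rintro c ⟨j, x, b, h1, h2, h3⟩
        rw [ha] at h1
        cases h1
        exact ⟨i, a', b, ha', h2, h3.trans hle⟩
      · right
        rintro c ⟨j, x, b, h1, h2, h3⟩
        rw [ha'] at h1
        cases h1
        exact ⟨i, a, b, ha, h2, h3.trans hle⟩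

variable {s t : κ → ℕ} {ρ : α → Option (Σ i, Fin (s i))} {γ : β → Option (Σ i, Fin (s i))}
  {ρ' : α → Option (Σ i, Fin (t i))} {γ' : β → Option (Σ i, Fin (t i))}

/-- Rows at consecutive levels are separated by a column starting at the upper level. The separation
is visible in the relation, so it forces a strict increase of the other level as well. -/
theorem row_level_le (hρ : HitsAll ρ) (hγ : HitsAll γ)
    (hA : levelRel ρ γ = levelRel ρ' γ') (hR : blockLabel ρ = blockLabel ρ')
    (x : ℕ) {r : α} {i : κ} {a : Fin (s i)} {a' : Fin (t i)}
    (hx : a = x) (h : ρ r = some ⟨i, a⟩) (h' : ρ' r = some ⟨i, a'⟩) : (a : ℕ) ≤ a' := by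
  induction x generalizing r a a' with
  | zero => omega
  | succ x ih =>
    have hlt : x < s i := by omega
    obtain ⟨r₁, h₁⟩ := hρ ⟨i, ⟨x, hlt⟩⟩
    have hl : blockLabel ρ' r₁ = some i := hR ▸ blockLabel_eq_some.2 ⟨_, h₁⟩
    obtain ⟨b', h₁'⟩ := blockLabel_eq_some.1 hl
    have hb := ih rfl h₁ h₁'
    obtain ⟨c, hc⟩ := hγ ⟨i, a⟩
    have hA1 : levelRel ρ γ r c := (levelRel_iff h hc).2 le_rfl
    have hA2 : ¬ levelRel ρ γ r₁ c := by
      rw [levelRel_iff h₁ hc, not_le, Fin.lt_def]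
      simp [hx]
    rw [hA] at hA1 hA2
    obtain ⟨j, u, v, e1, e2, huv⟩ := hA1
    rw [h'] at e1
    cases e1
    rw [levelRel_iff h₁' e2, not_le] at hA2
    simp only [Fin.le_def, Fin.lt_def] at *
    omega

theorem row_level_eq (hρ : HitsAll ρ) (hγ : HitsAll γ) (hρ' : HitsAll ρ') (hγ' : HitsAll γ')
    (hA : levelRel ρ γ = levelRel ρ' γ') (hR : blockLabel ρ = blockLabel ρ')
    {r : α} {i : κ} {a : Fin (s i)} {a' : Fin (t i)}
    (h : ρ r = some ⟨i, a⟩) (h' : ρ' r = some ⟨i, a'⟩) : (a : ℕ) = a' :=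
  le_antisymm (row_level_le hρ hγ hA hR a rfl h h')
    (row_level_le hρ' hγ' hA.symm hR.symm a' rfl h' h)

theorem col_level_le (hρ : HitsAll ρ) (hγ : HitsAll γ) (hρ' : HitsAll ρ') (hγ' : HitsAll γ')
    (hA : levelRel ρ γ = levelRel ρ' γ') (hR : blockLabel ρ = blockLabel ρ')
    {c : β} {i : κ} {b : Fin (s i)} {b' : Fin (t i)}
    (h : γ c = some ⟨i, b⟩) (h' : γ' c = some ⟨i, b'⟩) : (b' : ℕ) ≤ b := by
  obtain ⟨r, hr⟩ := hρ ⟨i, b⟩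
  have hl : blockLabel ρ' r = some i := hR ▸ blockLabel_eq_some.2 ⟨_, hr⟩
  obtain ⟨a', hr'⟩ := blockLabel_eq_some.1 hl
  have hA1 : levelRel ρ γ r c := (levelRel_iff hr h).2 le_rfl
  rw [hA, levelRel_iff hr' h', Fin.le_def] at hA1
  rwa [row_level_eq hρ hγ hρ' hγ' hA hR hr hr']

/-- A row at the top level s_i - 1 has the same level in the other description, so that level must
exist there. -/
theorem size_le (hs : ∀ i, 0 < s i)
    (hρ : HitsAll ρ) (hγ : HitsAll γ) (hρ' : HitsAll ρ') (hγ' : HitsAll γ')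
    (hA : levelRel ρ γ = levelRel ρ' γ') (hR : blockLabel ρ = blockLabel ρ') (i : κ) :
    s i ≤ t i := by
  obtain ⟨r, hr⟩ := hρ ⟨i, ⟨s i - 1, by have := hs i; omega⟩⟩
  have hl : blockLabel ρ' r = some i := hR ▸ blockLabel_eq_some.2 ⟨_, hr⟩
  obtain ⟨a', hr'⟩ := blockLabel_eq_some.1 hl
  have := row_level_eq hρ hγ hρ' hγ' hA hR hr hr'
  have h2 := a'.2
  simp only at this
  omega

theorem eq_of_level_eq {ρ ρ' : α → Option (Σ i, Fin (s i))} (hR : blockLabel ρ = blockLabel ρ')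
    (h : ∀ r i a a', ρ r = some ⟨i, a⟩ → ρ' r = some ⟨i, a'⟩ → (a : ℕ) = a') : ρ = ρ' := by
  funext r
  rcases hr : ρ r with _ | ⟨i, a⟩
  · exact (blockLabel_eq_none.1 (hR ▸ blockLabel_eq_none.2 hr)).symm
  · have hl : blockLabel ρ' r = some i := hR ▸ blockLabel_eq_some.2 ⟨_, hr⟩
    obtain ⟨a', hr'⟩ := blockLabel_eq_some.1 hl
    rw [hr', Fin.ext (h r i a a' hr hr')]

end Levels

/-! ### Reconstructing levels from a chain labeling -/

/-- The rank, i.e. the number of smaller elements, is injective from S to `range #S`, hence onto. -/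
theorem exists_card_filter_lt_eq (S : Finset ℕ) {a : ℕ} (ha : a < #S) :
    ∃ v ∈ S, #{u ∈ S | u < v} = a := by
  have hmono : ∀ v ∈ S, ∀ v' ∈ S, v < v' → #{u ∈ S | u < v} < #{u ∈ S | u < v'} := by
    intro v hv v' _ hlt
    refine Finset.card_lt_card (Finset.ssubset_iff_of_subset ?_ |>.2 ⟨v, by simp [hv, hlt], by simp⟩)
    intro u hu
    simp only [mem_filter] at hu ⊢
    exact ⟨hu.1, hu.2.trans hlt⟩
  have hmaps : Set.MapsTo (fun v => #{u ∈ S | u < v}) S (range #S) := by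
    intro v hv
    have hv' : v ∈ S := hv
    simp only [coe_range, Set.mem_Iio]
    refine Finset.card_lt_card (Finset.ssubset_iff_of_subset (filter_subset _ _) |>.2
      ⟨v, hv', by simp⟩)
  have hinj : Set.InjOn (fun v => #{u ∈ S | u < v}) S := by
    intro v hv v' hv' h
    by_contra hne
    rcases lt_or_gt_of_ne hne with hlt | hlt
    · exact (hmono v hv v' hv' hlt).ne h
    · exact (hmono v' hv' v hv hlt).ne' h
  obtain ⟨v, hv, h⟩ := Finset.surjOn_of_injOn_of_card_le _ hmaps hinj (by simp)
    (show a ∈ (range #S : Set ℕ) by simpa using ha)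
  exact ⟨v, hv, h⟩

/-- Every chain labeling comes from levels. -/
theorem IsChainLabeling.exists_levels {α β κ : Type*} [Finite α] [Finite β]
    {A : α → β → Prop} {R : α → Option κ} {C : β → Option κ} (h : IsChainLabeling A R C) :
    ∃ (s : κ → ℕ) (ρ : α → Option (Σ i, Fin (s i))) (γ : β → Option (Σ i, Fin (s i))),
      (∀ i, 1 ≤ s i ∧ s i ≤ Nat.card α) ∧ HitsAll ρ ∧ HitsAll γ ∧ levelRel ρ γ = A ∧
        blockLabel ρ = R ∧ blockLabel γ = C := by
  classical
  have := Fintype.ofFinite α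
  let w : α → ℕ := fun r => {c | A r c}.ncard
  have w_eq : ∀ {r r'}, (∀ c, A r c → A r' c) → w r' ≤ w r → ∀ c, A r' c → A r c := by
    intro r r' hsub hle c hc
    have := Set.eq_of_subset_of_ncard_le (s := {c | A r c}) (t := {c | A r' c}) hsub hle
    exact (Set.ext_iff.1 this c).2 hc
  have w_lt : ∀ {r r' c}, R r = R r' → A r c → ¬ A r' c → w r' < w r := by
    intro r r' c hr h1 h2
    rcases h.nested r r' hr with hs | hs
    · exact absurd (hs c h1) h2
    · by_contra hle
      exact h2 (w_eq hs (not_lt.1 hle) c h1)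
  have w_sub : ∀ {r r'}, R r = R r' → w r ≤ w r' → ∀ c, A r c → A r' c := by
    intro r r' hr hle c hc
    by_contra hcon
    exact absurd (w_lt hr hc hcon) (not_lt.2 hle)
  let S : κ → Finset ℕ := fun i => ({r | R r = some i} : Finset α).image w
  have mem_S : ∀ {i v}, v ∈ S i ↔ ∃ r, R r = some i ∧ w r = v := by
    intro i v
    simp [S]
  -- Within a block the weight `w` determines the row. The level of a row is the rank of its weight
  -- in the block; the level of a column is the rank of the lightest row meeting it.
  have hρ : ∀ r, ∃ o : Option (Σ i, Fin #(S i)), o.map Sigma.fst = R r ∧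
      ∀ i a, o = some ⟨i, a⟩ → (a : ℕ) = #{u ∈ S i | u < w r} := by
    intro r
    rcases hr : R r with _ | i
    · exact ⟨none, rfl, by simp⟩
    · have hlt : #{u ∈ S i | u < w r} < #(S i) :=
        Finset.card_lt_card (Finset.ssubset_iff_of_subset (filter_subset _ _) |>.2
          ⟨w r, mem_S.2 ⟨r, hr, rfl⟩, by simp⟩)
      refine ⟨some ⟨i, ⟨_, hlt⟩⟩, rfl, fun j a hj => ?_⟩
      cases hj
      rfl
  have hγ : ∀ c, ∃ o : Option (Σ i, Fin #(S i)), o.map Sigma.fst = C c ∧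
      ∀ i a, o = some ⟨i, a⟩ → (a : ℕ) = #{u ∈ S i | ∀ r, A r c → u < w r} := by
    intro c
    rcases hc : C c with _ | i
    · exact ⟨none, rfl, by simp⟩
    · obtain ⟨r, hr⟩ := (h.col c).1 (by simp [hc])
      have hlt : #{u ∈ S i | ∀ r, A r c → u < w r} < #(S i) :=
        Finset.card_lt_card (Finset.ssubset_iff_of_subset (filter_subset _ _) |>.2
          ⟨w r, mem_S.2 ⟨r, (h.comp r c hr).trans hc, rfl⟩, fun hm =>
            lt_irrefl _ ((mem_filter.1 hm).2 r hr)⟩)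
      refine ⟨some ⟨i, ⟨_, hlt⟩⟩, rfl, fun j a hj => ?_⟩
      cases hj
      rfl
  choose ρ hρ1 hρ2 using hρ
  choose γ hγ1 hγ2 using hγ
  have hR : blockLabel ρ = R := funext hρ1
  have hC : blockLabel γ = C := funext hγ1
  refine ⟨fun i => #(S i), ρ, γ, fun i => ⟨?_, ?_⟩, ?_, ?_, ?_, hR, hC⟩
  · obtain ⟨r, hr⟩ := h.surj i
    exact Finset.card_pos.2 ⟨w r, mem_S.2 ⟨r, hr, rfl⟩⟩
  · rw [Nat.card_eq_fintype_card]
    exact Finset.card_image_le.trans (Finset.card_le_univ _)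
  · rintro ⟨i, a⟩
    obtain ⟨v, hv, hva⟩ := exists_card_filter_lt_eq (S i) a.2
    obtain ⟨r, hr, rfl⟩ := mem_S.1 hv
    obtain ⟨a', ha'⟩ := blockLabel_eq_some.1 ((congrFun hR r).trans hr)
    refine ⟨r, ?_⟩
    rw [ha', Fin.ext ((hρ2 r i a' ha').trans hva)]
  · rintro ⟨i, b⟩
    obtain ⟨v, hv, hvb⟩ := exists_card_filter_lt_eq (S i) b.2
    obtain ⟨r, hr, rfl⟩ := mem_S.1 hv
    -- Some column starts exactly at r. Otherwise every column of r meets a lighter row, and by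
    -- nestedness the heaviest of the lighter rows in the block would contain all of r.
    obtain ⟨c, hc, hmin⟩ : ∃ c, A r c ∧ ∀ r', A r' c → w r ≤ w r' := by
      by_contra! hcon
      obtain ⟨c₀, hc₀⟩ := (h.row r).1 (by simp [hr])
      obtain ⟨r₀, hr₀, hw₀⟩ := hcon c₀ hc₀
      have hr₀' : R r₀ = some i := ((h.comp _ _ hr₀).trans (h.comp _ _ hc₀).symm).trans hr
      obtain ⟨r₁, hr₁, hmax⟩ := Finset.exists_max_image
        ({r' | R r' = some i ∧ w r' < w r} : Finset α) w ⟨r₀, by simp [hr₀', hw₀]⟩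
      simp only [mem_filter, mem_univ, true_and] at hr₁ hmax
      refine absurd hr₁.2 (not_lt.2 (Set.ncard_le_ncard (s := {c | A r c}) ?_))
      intro c hc
      obtain ⟨r', hr', hw'⟩ := hcon c hc
      have hl : R r' = some i := ((h.comp _ _ hr').trans (h.comp _ _ hc).symm).trans hr
      exact w_sub (hl.trans hr₁.1.symm) (hmax r' ⟨hl, hw'⟩) c hr'
    obtain ⟨b', hb'⟩ := blockLabel_eq_some.1
      ((congrFun hC c).trans ((h.comp r c hc).symm.trans hr))
    refine ⟨c, ?_⟩
    rw [hb', Fin.ext ((hγ2 c i b' hb').trans (Eq.trans ?_ hvb))]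
    congr 1
    refine Finset.filter_congr fun u _ => ⟨fun hu => hu r hc, fun hu r' hr' => ?_⟩
    exact hu.trans_le (hmin r' hr')
  · funext r c
    apply propext
    constructor
    · rintro ⟨i, a, b, hr, hc, hba⟩
      have hRr : R r = some i := (congrFun hR r).symm.trans (blockLabel_eq_some.2 ⟨a, hr⟩)
      have hCc : C c = some i := (congrFun hC c).symm.trans (blockLabel_eq_some.2 ⟨b, hc⟩)
      rw [Fin.le_def, hρ2 r i a hr, hγ2 c i b hc] at hba
      by_contra hcon
      -- If r misses c, every row meeting c is heavier than r, so `w r` itself is counted for c but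
      -- not for r.
      refine absurd hba (not_le.2 (Finset.card_lt_card (Finset.ssubset_iff_of_subset ?_ |>.2
        ⟨w r, ?_, by simp⟩)))
      · intro u hu
        simp only [mem_filter] at hu ⊢
        exact ⟨hu.1, fun r' hr' => hu.2.trans
          (w_lt (((h.comp _ _ hr').trans hCc).trans hRr.symm) hr' hcon)⟩
      · exact mem_filter.2 ⟨mem_S.2 ⟨r, hRr, rfl⟩, fun r' hr' =>
          w_lt (((h.comp _ _ hr').trans hCc).trans hRr.symm) hr' hcon⟩
    · intro hA
      obtain ⟨i, hi⟩ := Option.ne_none_iff_exists'.1 ((h.row r).2 ⟨c, hA⟩)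
      obtain ⟨a, ha⟩ := blockLabel_eq_some.1 ((congrFun hR r).trans hi)
      obtain ⟨b, hb⟩ := blockLabel_eq_some.1
        ((congrFun hC c).trans ((h.comp r c hA).symm.trans hi))
      refine ⟨i, a, b, ha, hb, ?_⟩
      rw [Fin.le_def, hρ2 r i a ha, hγ2 c i b hb]
      refine Finset.card_le_card fun u hu => ?_
      simp only [mem_filter] at hu ⊢
      exact ⟨hu.1, hu.2 r hA⟩

/-- Chain labelings correspond to choices of block sizes and levels. -/
theorem card_isChainLabeling (m n k : ℕ) :
    Nat.card {x : (Fin m → Fin n → Prop) × (Fin m → Option (Fin k)) × (Fin n → Option (Fin k)) //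
      IsChainLabeling x.1 x.2.1 x.2.2} =
    ∑ s ∈ Fintype.piFinset fun _ : Fin k => Icc 1 m,
      hitCount (∑ i, s i) m * hitCount (∑ i, s i) n := by
  classical
  set P := Fintype.piFinset fun _ : Fin k => Icc 1 m with hP
  have h1 : ∀ s : Fin k → ℕ, hitCount (∑ i, s i) m * hitCount (∑ i, s i) n =
      Nat.card ({ρ : Fin m → Option (Σ i, Fin (s i)) // HitsAll ρ} ×
        {γ : Fin n → Option (Σ i, Fin (s i)) // HitsAll γ}) := fun s => by
    rw [Nat.card_prod, card_hitsAll, card_hitsAll]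
    simp [Nat.card_eq_fintype_card]
  rw [Finset.sum_congr rfl fun s _ => h1 s, ← Finset.sum_coe_sort P, ← Nat.card_sigma]
  have pos : ∀ s : P, ∀ i, 0 < s.1 i := fun s i =>
    (mem_Icc.1 (Fintype.mem_piFinset.1 s.2 i)).1
  symm
  refine Nat.card_congr (Equiv.ofBijective (fun x => ⟨(levelRel x.2.1.1 x.2.2.1,
    blockLabel x.2.1.1, blockLabel x.2.2.1),
    isChainLabeling_levelRel (pos x.1) x.2.1.2 x.2.2.2⟩) ⟨?_, ?_⟩)
  · rintro ⟨⟨s, hs⟩, ⟨ρ, hρ⟩, ⟨γ, hγ⟩⟩ ⟨⟨t, ht⟩, ⟨ρ', hρ'⟩, ⟨γ', hγ'⟩⟩ h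
    simp only [Subtype.mk.injEq, Prod.mk.injEq] at h
    obtain ⟨hA, hR, hC⟩ := h
    obtain rfl : s = t := funext fun i => le_antisymm
      (size_le (pos ⟨s, hs⟩) hρ hγ hρ' hγ' hA hR i)
      (size_le (pos ⟨t, ht⟩) hρ' hγ' hρ hγ hA.symm hR.symm i)
    obtain rfl := eq_of_level_eq hR fun r i a a' => row_level_eq hρ hγ hρ' hγ' hA hR
    obtain rfl := eq_of_level_eq hC fun c i b b' h h' => le_antisymm
      (col_level_le hρ' hγ' hρ hγ hA.symm hR.symm h' h)
      (col_level_le hρ hγ hρ' hγ' hA hR h h')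
    rfl
  · rintro ⟨⟨A, R, C⟩, h⟩
    obtain ⟨s, ρ, γ, hs, hρ, hγ, rfl, rfl, rfl⟩ := h.exists_levels
    have hsP : s ∈ P := Fintype.mem_piFinset.2 fun i => mem_Icc.2 (by simpa using hs i)
    exact ⟨⟨⟨s, hsP⟩, ⟨ρ, hρ⟩, ⟨γ, hγ⟩⟩, rfl⟩

/-! ### Lonesum decomposable matrices and chain labelings -/

theorem mem_iff_lt_card_of_isLowerSet {n : ℕ} {T : Finset (Fin n)}
    (hT : ∀ a ∈ T, ∀ b ≤ a, b ∈ T) (j : Fin n) : j ∈ T ↔ (j : ℕ) < #T := by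
  constructor
  · intro hj
    have := Finset.card_le_card (s := Iic j) (t := T) fun b hb => hT j hj b (mem_Iic.1 hb)
    rw [Fin.card_Iic] at this
    omega
  · intro hj
    by_contra hcon
    have := Finset.card_le_card (s := T) (t := Iio j) fun b hb => by
      rw [mem_Iio]
      by_contra hle
      exact hcon (hT b hb j (not_lt.1 hle))
    rw [Fin.card_Iio] at this
    omega

/-- Let t_i be the i-th row sum. The weight 2t_i - 1 - 2j is a function of the row plus a function
of the column, so equal margins make F - B orthogonal to it. It is positive where F is 1, negative
where F is 0, and odd, so every term is nonnegative and F = B. -/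
theorem IsFerrers.isLonesum {m n : ℕ} {F : ZeroOneMatrix m n} (hF : IsFerrers F) : IsLonesum F := by
  intro B hr hc
  let T : Fin m → Finset (Fin n) := fun i => {j | F i j ≠ 0}
  have hT : ∀ i j, F i j ≠ 0 ↔ (j : ℕ) < #(T i) := fun i j => by
    rw [← mem_iff_lt_card_of_isLowerSet (T := T i)]
    · simp [T]
    · intro a ha b hb
      simp only [T, mem_filter, mem_univ, true_and] at ha ⊢
      exact fun h0 => ha (hF.2 i b h0 a hb)
  have sum_zero : ∑ i, ∑ j, (((F i j : ℕ) : ℤ) - ((B i j : ℕ) : ℤ)) * (2 * #(T i) - 1 - 2 * j) = 0 := by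
    have e1 : ∀ i, ∑ j, (((F i j : ℕ) : ℤ) - ((B i j : ℕ) : ℤ)) = 0 := fun i => by
      have := congrArg (Nat.cast (R := ℤ)) (congrFun hr i)
      simp only [rowSums, Nat.cast_sum] at this
      rw [Finset.sum_sub_distrib, this, sub_self]
    have e2 : ∀ j, ∑ i, (((F i j : ℕ) : ℤ) - ((B i j : ℕ) : ℤ)) = 0 := fun j => by
      have := congrArg (Nat.cast (R := ℤ)) (congrFun hc j)
      simp only [colSums, Nat.cast_sum] at this
      rw [Finset.sum_sub_distrib, this, sub_self]
    simp only [mul_sub _ _ (2 * ((_ : ℕ) : ℤ)), Finset.sum_sub_distrib]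
    rw [Finset.sum_comm (f := fun i j => (((F i j : ℕ) : ℤ) - ((B i j : ℕ) : ℤ)) * (2 * (j : ℕ)))]
    simp only [← Finset.sum_mul, e1, e2, zero_mul, Finset.sum_const_zero, sub_zero]
  have nonneg : ∀ i j, 0 ≤ (((F i j : ℕ) : ℤ) - ((B i j : ℕ) : ℤ)) * (2 * #(T i) - 1 - 2 * j) := by
    intro i j
    have hB := (B i j).2
    by_cases h : F i j = 0
    · have h2 := mt (hT i j).2 (not_not.2 h)
      rw [h]
      exact mul_nonneg_of_nonpos_of_nonpos (by simp) (by omega)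
    · have h2 := (hT i j).1 h
      have h3 : F i j = 1 := by omega
      rw [h3]
      refine mul_nonneg ?_ (by omega)
      have : (((1 : Fin 2) : ℕ) : ℤ) = 1 := rfl
      omega
  ext i j
  have h1 := (Finset.sum_eq_zero_iff_of_nonneg fun i _ =>
    Finset.sum_nonneg fun j _ => nonneg i j).1 sum_zero i (mem_univ i)
  have h2 := (Finset.sum_eq_zero_iff_of_nonneg fun j _ => nonneg i j).1 h1 j (mem_univ j)
  rcases mul_eq_zero.1 h2 with h | h <;> omega

/-- Appending one more block to a disjoint union of blocks. -/
noncomputable def sigmaSumEquiv {k : ℕ} (p : Fin k → ℕ) (r : ℕ) :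
    (Σ i, Fin (p i)) ⊕ Fin r ≃ Σ i, Fin ((Fin.cons r p : Fin (k + 1) → ℕ) i) :=
  Equiv.ofBijective
    (Sum.elim (fun x => ⟨x.1.succ, x.2⟩) fun b => ⟨0, b⟩) (by
      constructor
      · rintro (⟨i, a⟩ | b) (⟨j, a'⟩ | b') h
        · obtain rfl : i = j := Fin.succ_injective _ (congrArg Sigma.fst h)
          exact congrArg (fun x => Sum.inl (Sigma.mk i x)) (eq_of_heq (Sigma.mk.inj h).2)
        · exact absurd (congrArg Sigma.fst h) (Fin.succ_ne_zero i)
        · exact absurd (congrArg Sigma.fst h).symm (Fin.succ_ne_zero j)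
        · exact congrArg Sum.inr (eq_of_heq (Sigma.mk.inj h).2)
      · rintro ⟨i, a⟩
        refine Fin.cases (fun a => ⟨Sum.inr a, rfl⟩) (fun i a => ⟨Sum.inl ⟨i, a⟩, rfl⟩) i a)

/-- The zero block is also Ferrers, hence lonesum; it becomes the block with index 0. -/
theorem HasDecompositionOrder.isLonesumDecomposable {m n k : ℕ} {A : ZeroOneMatrix m n}
    (h : HasDecompositionOrder A k) : IsLonesumDecomposable A := by
  obtain ⟨p, q, r, s, F, e, f, -, hF, rfl⟩ := h
  let L : ∀ i : Fin (k + 1), ZeroOneMatrix ((Fin.cons r p : Fin (k + 1) → ℕ) i)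
    ((Fin.cons s q : Fin (k + 1) → ℕ) i) :=
      Fin.cases (0 : ZeroOneMatrix r s) F
  refine ⟨k + 1, Fin.cons r p, Fin.cons s q, L, e.trans (sigmaSumEquiv p r),
    f.trans (sigmaSumEquiv q s), ?_, ?_⟩
  · refine Fin.cases ?_ fun i => ?_
    · exact IsFerrers.isLonesum (F := (0 : ZeroOneMatrix r s)) ⟨fun _ _ _ _ _ => rfl, fun _ _ _ _ _ => rfl⟩
    · exact (hF i).1.isLonesum
  · ext x y
    simp only [Matrix.submatrix_apply, Equiv.trans_apply]
    congr 1
    rcases e x with ⟨i, a⟩ | b <;> rcases f y with ⟨j, a'⟩ | b'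
    · by_cases hij : i = j
      · subst hij
        rw [Matrix.fromBlocks_apply₁₁, Matrix.blockDiagonal'_apply_eq]
        exact (Matrix.blockDiagonal'_apply_eq L i.succ a a').symm
      · rw [Matrix.fromBlocks_apply₁₁, Matrix.blockDiagonal'_apply_ne _ _ _ hij]
        exact (Matrix.blockDiagonal'_apply_ne L (k := i.succ) (k' := j.succ) a a'
          fun h0 => hij (Fin.succ_injective _ h0)).symm
    · exact (Matrix.blockDiagonal'_apply_ne L (k := i.succ) (k' := 0) a b'
        (Fin.succ_ne_zero i)).symm
    · exact (Matrix.blockDiagonal'_apply_ne L (k := 0) (k' := j.succ) b a'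
        (Fin.succ_ne_zero j).symm).symm
    · exact (Matrix.blockDiagonal'_apply_eq L 0 b b').symm

theorem HasDecompositionOrder.exists_isChainLabeling {m n k : ℕ} {A : ZeroOneMatrix m n}
    (h : HasDecompositionOrder A k) : ∃ (R : Fin m → Option (Fin k)) (C : Fin n → Option (Fin k)),
      IsChainLabeling (fun r c => A r c ≠ 0) R C := by
  obtain ⟨p, q, r, s, F, e, f, hpos, hF, rfl⟩ := h
  let lr : (Σ i, Fin (p i)) ⊕ Fin r → Option (Fin k) := Sum.elim (fun x => some x.1) fun _ => none
  let lc : (Σ i, Fin (q i)) ⊕ Fin s → Option (Fin k) := Sum.elim (fun x => some x.1) fun _ => none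
  have key : ∀ (x : (Σ i, Fin (p i)) ⊕ Fin r) (y : (Σ i, Fin (q i)) ⊕ Fin s), Matrix.fromBlocks (Matrix.blockDiagonal' F) 0 0 0 x y ≠ 0 ↔
      ∃ i a b, x = Sum.inl ⟨i, a⟩ ∧ y = Sum.inl ⟨i, b⟩ ∧ F i a b ≠ 0 := by
    rintro (⟨i, a⟩ | b) (⟨j, a'⟩ | b')
    · rw [Matrix.fromBlocks_apply₁₁]
      constructor
      · intro hne
        obtain rfl : i = j := by
          by_contra hij
          exact hne (Matrix.blockDiagonal'_apply_ne _ _ _ hij)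
        rw [Matrix.blockDiagonal'_apply_eq] at hne
        exact ⟨i, a, a', rfl, rfl, hne⟩
      · rintro ⟨l, u, v, h1, h2, h3⟩
        cases h1
        cases h2
        rwa [Matrix.blockDiagonal'_apply_eq]
    · simp
    · simp
    · simp
  refine ⟨fun x => lr (e x), fun y => lc (f y), ?_, ?_, ?_, ?_, ?_⟩
  · intro x y hxy
    obtain ⟨i, a, b, h1, h2, -⟩ := (key _ _).1 hxy
    simp [lr, lc, h1, h2]
  · intro x
    constructor
    · intro hx
      rcases he : e x with ⟨i, a⟩ | b
      · obtain ⟨b, hb⟩ := (hF i).2.1 a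
        refine ⟨f.symm (Sum.inl ⟨i, b⟩), (key _ _).2 ⟨i, a, b, he, ?_, hb⟩⟩
        simp
      · simp [lr, he] at hx
    · rintro ⟨y, hy⟩
      obtain ⟨i, a, b, h1, -⟩ := (key _ _).1 hy
      simp [lr, h1]
  · intro y
    constructor
    · intro hy
      rcases he : f y with ⟨i, b⟩ | b
      · obtain ⟨a, ha⟩ := (hF i).2.2 b
        refine ⟨e.symm (Sum.inl ⟨i, a⟩), (key _ _).2 ⟨i, a, b, ?_, he, ha⟩⟩
        simp
      · simp [lc, he] at hy
    · rintro ⟨x, hx⟩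
      obtain ⟨i, a, b, -, h2, -⟩ := (key _ _).1 hx
      simp [lc, h2]
  · exact fun i => ⟨e.symm (Sum.inl ⟨i, ⟨0, (hpos i).1⟩⟩), by simp [lr]⟩
  · intro x x' hxx
    simp only [Matrix.submatrix_apply, key]
    rcases he : e x with ⟨i, a⟩ | b
    · rcases he' : e x' with ⟨j, a'⟩ | b'
      · obtain rfl : i = j := by simpa [lr, he, he'] using hxx
        have mono : ∀ u v, u ≤ v → ∀ b, F i v b ≠ 0 → F i u b ≠ 0 := fun u v huv b hv hu =>
          hv ((hF i).1.1 u b hu v huv)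
        rcases le_total a a' with hle | hle
        · right
          rintro y ⟨l, u, v, h1, h2, h3⟩
          cases h1
          exact ⟨i, a, v, rfl, h2, mono _ _ hle v h3⟩
        · left
          rintro y ⟨l, u, v, h1, h2, h3⟩
          cases h1
          exact ⟨i, a', v, rfl, h2, mono _ _ hle v h3⟩
      · right
        rintro y ⟨l, u, v, h1, -⟩
        cases h1
    · left
      rintro y ⟨l, u, v, h1, -⟩
      cases h1

theorem exists_monotone_equiv {τ ω : Type*} [Fintype τ] [LinearOrder ω] (w : τ → ω) :
    ∃ g : Fin (Fintype.card τ) ≃ τ, Monotone (w ∘ g) := by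
  let g := (Fintype.equivFin τ).symm
  exact ⟨(Tuple.sort (w ∘ g)).trans g, Tuple.monotone_sort (w ∘ g)⟩

/-- Numbering the elements of a finite type block by block, sorted by weight in each block. -/
theorem exists_sorted_block_equiv {α ω : Type*} [Finite α] [LinearOrder ω] {k : ℕ}
    (R : α → Option (Fin k)) (w : α → ω) :
    ∃ (p : Fin k → ℕ) (r : ℕ) (e : α ≃ (Σ i, Fin (p i)) ⊕ Fin r),
      (∀ i a, R (e.symm (Sum.inl ⟨i, a⟩)) = some i) ∧ (∀ b, R (e.symm (Sum.inr b)) = none) ∧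
      ∀ i, Monotone fun a => w (e.symm (Sum.inl ⟨i, a⟩)) := by
  classical
  have := Fintype.ofFinite α
  choose g hg using fun o : Option (Fin k) =>
    exists_monotone_equiv fun x : {x // R x = o} => w x.1
  let φ : (Σ i : Fin k, Fin (Fintype.card {x // R x = some i})) ⊕
      Fin (Fintype.card {x // R x = none}) → α :=
    Sum.elim (fun x => (g (some x.1) x.2).1) fun b => (g none b).1
  have h1 : ∀ i a, R (φ (Sum.inl ⟨i, a⟩)) = some i := fun i a => (g (some i) a).2
  have h2 : ∀ b, R (φ (Sum.inr b)) = none := fun b => (g none b).2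
  have hφ : Function.Bijective φ := by
    constructor
    · rintro (⟨i, a⟩ | b) (⟨j, a'⟩ | b') h
      · obtain rfl : i = j := by
          have := congrArg R h
          rw [h1, h1] at this
          simpa using this
        exact congrArg (fun x => Sum.inl (Sigma.mk i x)) ((g (some i)).injective (Subtype.ext h))
      · have := congrArg R h
        rw [h1, h2] at this
        cases this
      · have := congrArg R h
        rw [h1, h2] at this
        cases this
      · exact congrArg Sum.inr ((g none).injective (Subtype.ext h))
    · intro x
      rcases hx : R x with _ | i
      · exact ⟨Sum.inr ((g none).symm ⟨x, hx⟩), by simp [φ]⟩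
      · exact ⟨Sum.inl ⟨i, (g (some i)).symm ⟨x, hx⟩⟩, by simp [φ]⟩
  exact ⟨_, _, (Equiv.ofBijective φ hφ).symm, h1, h2, fun i => hg (some i)⟩

theorem IsChainLabeling.row_mono {α β κ : Type*} [Finite β] {A : α → β → Prop}
    {R : α → Option κ} {C : β → Option κ} (h : IsChainLabeling A R C) {r r' : α} (hr : R r = R r')
    (hle : {c | A r c}.ncard ≤ {c | A r' c}.ncard) {c : β} (hc : A r c) : A r' c := by
  rcases h.nested r r' hr with hs | hs
  · exact hs c hc
  · have := Set.eq_of_subset_of_ncard_le (s := {c | A r' c}) (t := {c | A r c}) hs hle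
    exact (Set.ext_iff.1 this c).2 hc

/-- Sorting nested rows and nested columns by decreasing sum puts each block into Ferrers form;
`OrderDual` reverses the order of the sort. -/
theorem IsChainLabeling.hasDecompositionOrder {m n k : ℕ} {A : ZeroOneMatrix m n}
    {R : Fin m → Option (Fin k)} {C : Fin n → Option (Fin k)}
    (h : IsChainLabeling (fun r c => A r c ≠ 0) R C) : HasDecompositionOrder A k := by
  obtain ⟨p, r, e, he1, he2, he3⟩ := exists_sorted_block_equiv R
    fun x => OrderDual.toDual {c | A x c ≠ 0}.ncard
  obtain ⟨q, s, f, hf1, hf2, hf3⟩ := exists_sorted_block_equiv C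
    fun y => OrderDual.toDual {x | A x y ≠ 0}.ncard
  have he4 : ∀ x i, R x = some i → ∃ a, x = e.symm (Sum.inl ⟨i, a⟩) := by
    intro x i hx
    obtain ⟨z, rfl⟩ := e.symm.surjective x
    rcases z with ⟨j, a⟩ | b
    · obtain rfl : j = i := by simpa [he1] using hx
      exact ⟨a, rfl⟩
    · rw [he2] at hx
      cases hx
  have hf4 : ∀ y i, C y = some i → ∃ a, y = f.symm (Sum.inl ⟨i, a⟩) := by
    intro x i hx
    obtain ⟨z, rfl⟩ := f.symm.surjective x
    rcases z with ⟨j, a⟩ | b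
    · obtain rfl : j = i := by simpa [hf1] using hx
      exact ⟨a, rfl⟩
    · rw [hf2] at hx
      cases hx
  let F : ∀ i, ZeroOneMatrix (p i) (q i) := fun i =>
    Matrix.of fun a b => A (e.symm (Sum.inl ⟨i, a⟩)) (f.symm (Sum.inl ⟨i, b⟩))
  refine ⟨p, q, r, s, F, e, f,
    fun i => ⟨?_, ?_⟩, fun i => ⟨⟨?_, ?_⟩, ?_, ?_⟩, ?_⟩
  · obtain ⟨x, hx⟩ := h.surj i
    obtain ⟨a, -⟩ := he4 x i hx
    exact a.pos
  · obtain ⟨y, hy⟩ := h.swap.surj i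
    obtain ⟨b, -⟩ := hf4 y i hy
    exact b.pos
  · intro a b h0 a' haa
    by_contra hcon
    exact h.row_mono (by rw [he1, he1]) (he3 i haa) hcon h0
  · intro a b h0 b' hbb
    by_contra hcon
    exact h.swap.row_mono (by rw [hf1, hf1]) (hf3 i hbb) hcon h0
  · intro a
    obtain ⟨y, hy⟩ := (h.row (e.symm (Sum.inl ⟨i, a⟩))).1 (by simp [he1])
    obtain ⟨b, rfl⟩ := hf4 y i ((h.comp _ _ hy).symm.trans (he1 i a))
    exact ⟨b, hy⟩
  · intro b
    obtain ⟨x, hx⟩ := (h.col (f.symm (Sum.inl ⟨i, b⟩))).1 (by simp [hf1])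
    obtain ⟨a, rfl⟩ := he4 x i ((h.comp _ _ hx).trans (hf1 i b))
    exact ⟨a, hx⟩
  · have hz : ∀ x y, R x ≠ C y → A x y = 0 := fun x y hne => by
      by_contra hcon
      exact hne (h.comp x y hcon)
    have hz' : ∀ x y, R x = none → A x y = 0 := fun x y hx => by
      by_contra hcon
      exact (h.row x).2 ⟨y, hcon⟩ hx
    ext x y
    obtain ⟨x, rfl⟩ := e.symm.surjective x
    obtain ⟨y, rfl⟩ := f.symm.surjective y
    rw [Matrix.submatrix_apply, Equiv.apply_symm_apply, Equiv.apply_symm_apply]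
    congr 1
    rcases x with ⟨i, a⟩ | b
    · rcases y with ⟨j, a'⟩ | b'
      · rw [Matrix.fromBlocks_apply₁₁]
        by_cases hij : i = j
        · subst hij
          rw [Matrix.blockDiagonal'_apply_eq]
          rfl
        · rw [Matrix.blockDiagonal'_apply_ne _ _ _ hij]
          exact hz _ _ (by rw [he1, hf1]; simpa using hij)
      · exact hz _ _ (by rw [he1, hf2]; simp)
    · rw [hz' _ _ (he2 b)]
      rcases y with y | y <;> rfl

theorem hasDecompositionOrder_iff {m n k : ℕ} {A : ZeroOneMatrix m n} :
    HasDecompositionOrder A k ↔ ∃ P : (Fin m → Option (Fin k)) × (Fin n → Option (Fin k)),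
      IsChainLabeling (fun r c => A r c ≠ 0) P.1 P.2 :=
  ⟨fun h => let ⟨R, C, hRC⟩ := h.exists_isChainLabeling; ⟨(R, C), hRC⟩,
    fun ⟨_, h⟩ => h.hasDecompositionOrder⟩

/-! ### Counting matrices, compositions and the final identity -/

theorem lonesumD_eq (k m n : ℕ) : lonesumD k m n =
    Nat.card {A : Fin m → Fin n → Prop // ∃ P : (Fin m → Option (Fin k)) × (Fin n → Option (Fin k)),
      IsChainLabeling A P.1 P.2} := by
  classical
  let g : ZeroOneMatrix m n → Fin m → Fin n → Prop := fun A r c => A r c ≠ 0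
  have hg : Function.Bijective g := by
    constructor
    · intro A B hAB
      ext r c
      have h1 : A r c ≠ 0 ↔ B r c ≠ 0 := iff_of_eq (congrFun (congrFun hAB r) c)
      have h2 := (A r c).2
      have h3 := (B r c).2
      rw [Ne, Ne, Fin.ext_iff, Fin.ext_iff] at h1
      simp only [Fin.val_zero] at h1
      omega
    · intro A
      refine ⟨fun r c => if A r c then 1 else 0, ?_⟩
      funext r c
      simp [g]
  exact Nat.card_congr ((Equiv.ofBijective g hg).subtypeEquiv fun A =>
    ⟨fun h => hasDecompositionOrder_iff.1 h.2, fun h =>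
      have h' := hasDecompositionOrder_iff.2 h
      ⟨h'.isLonesumDecomposable, h'⟩⟩)

/-- Chain labelings are counted by their relation; each fibre is a copy of the permutations of the
block names. -/
theorem lonesumD_mul_factorial (k m n : ℕ) :
    lonesumD k m n * k.factorial = ∑ s ∈ Fintype.piFinset fun _ : Fin k => Icc 1 m,
      hitCount (∑ i, s i) m * hitCount (∑ i, s i) n := by
  rw [← card_isChainLabeling, lonesumD_eq]
  have h1 : k.factorial = Nat.card (Equiv.Perm (Fin k)) := by
    rw [Nat.card_perm, Nat.card_eq_fintype_card, Fintype.card_fin]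
  rw [h1, ← Nat.card_prod]
  let fiber (A : Fin m → Fin n → Prop) : Type :=
    {P : (Fin m → Option (Fin k)) × (Fin n → Option (Fin k)) // IsChainLabeling A P.1 P.2}
  have e : ∀ A : {A : Fin m → Fin n → Prop //
      ∃ P : (Fin m → Option (Fin k)) × (Fin n → Option (Fin k)), IsChainLabeling A P.1 P.2},
      Nonempty (Equiv.Perm (Fin k) ≃ fiber A.1) := fun ⟨A, P, h⟩ => h.nonempty_perm_equiv
  refine Nat.card_congr (((Equiv.sigmaEquivProd _ _).symm.trans
    (Equiv.sigmaCongrRight fun A => (e A).some)).trans ⟨fun x => ⟨(x.1.1, x.2.1), x.2.2⟩,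
      fun x => ⟨⟨x.1.1, x.1.2, x.2⟩, ⟨x.1.2, x.2⟩⟩, fun x => rfl, fun x => rfl⟩)

/-- The coefficients of `(X / (1 - X)) ^ k` count compositions into `k` positive parts. -/
theorem card_filter_sum_eq_coeff {k m j : ℕ} (hj : j ≤ m) :
    (#{s ∈ Fintype.piFinset fun _ : Fin k => Icc 1 m | ∑ i, s i = j} : ℚ) =
      coeff j (((mk 1 : PowerSeries ℚ) - 1) ^ k) := by
  classical
  have h1 : ((mk 1 : PowerSeries ℚ) - 1) ^ k = ∏ _i : Fin k, ((mk 1 : PowerSeries ℚ) - 1) := by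
    simp
  have h2 : ∀ l, coeff l ((mk 1 : PowerSeries ℚ) - 1) = if l = 0 then 0 else 1 := fun l => by
    rw [map_sub, coeff_mk, coeff_one]
    split_ifs <;> simp
  rw [h1, coeff_prod]
  have h3 : ∀ l : Fin k →₀ ℕ, ∏ i, coeff (l i) ((mk 1 : PowerSeries ℚ) - 1) =
      if ∀ i, l i ≠ 0 then 1 else 0 := fun l => by
    simp only [h2]
    split_ifs with h
    · exact Finset.prod_eq_one fun i _ => if_neg (h i)
    · push Not at h
      obtain ⟨i, hi⟩ := h
      exact Finset.prod_eq_zero (mem_univ i) (if_pos hi)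
  rw [Finset.sum_congr rfl fun l _ => h3 l, Finset.sum_boole]
  congr 1
  refine Finset.card_bij' (fun s _ => Finsupp.equivFunOnFinite.symm s) (fun l _ => l) ?_ ?_ ?_ ?_
  · intro s hs
    simp only [mem_filter, Fintype.mem_piFinset, mem_Icc] at hs
    simp only [mem_filter, mem_finsuppAntidiag, Finsupp.equivFunOnFinite_symm_apply_apply]
    refine ⟨⟨hs.2, Finset.subset_univ _⟩, fun i => ?_⟩
    have := (hs.1 i).1
    omega
  · intro l hl
    simp only [mem_filter, mem_finsuppAntidiag] at hl
    simp only [mem_filter, Fintype.mem_piFinset, mem_Icc]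
    refine ⟨fun i => ⟨Nat.one_le_iff_ne_zero.2 (hl.2 i), ?_⟩, hl.1.1⟩
    exact (Finset.single_le_sum (f := fun i => l i) (fun _ _ => Nat.zero_le _) (mem_univ i)).trans
      (hl.1.1.le.trans hj)
  · intro s _
    rfl
  · intro l _
    ext i
    rfl

theorem sum_hitCount_eq (k m n : ℕ) :
    ((∑ s ∈ Fintype.piFinset fun _ : Fin k => Icc 1 m,
      hitCount (∑ i, s i) m * hitCount (∑ i, s i) n : ℕ) : ℚ) =
    ∑ j ∈ range (m + 1), coeff j (((mk 1 : PowerSeries ℚ) - 1) ^ k) *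
      ((hitCount j m : ℚ) * hitCount j n) := by
  -- Sums exceeding m contribute nothing. For j ≤ m the bound s_i ≤ m is automatic, so all
  -- compositions of j are present.
  have hz : ∀ s ∈ Fintype.piFinset fun _ : Fin k => Icc 1 m,
      hitCount (∑ i, s i) m * hitCount (∑ i, s i) n ≠ 0 → ∑ i, s i ∈ range (m + 1) := by
    intro s _ hs
    by_contra hcon
    rw [hitCount_eq_zero (by simpa using hcon), zero_mul] at hs
    exact hs rfl
  rw [← Finset.sum_filter_of_ne hz,
    ← Finset.sum_fiberwise_of_maps_to (t := range (m + 1)) (g := fun s : Fin k → ℕ => ∑ i, s i)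
      fun s hs => (mem_filter.1 hs).2, Nat.cast_sum]
  refine Finset.sum_congr rfl fun j hj => ?_
  have hj' : j ≤ m := Nat.lt_succ_iff.1 (mem_range.1 hj)
  rw [← card_filter_sum_eq_coeff hj', Finset.filter_filter,
    Finset.sum_congr rfl (g := fun _ => hitCount j m * hitCount j n) fun s hs => by
      rw [(mem_filter.1 hs).2.2], Finset.sum_const, smul_eq_mul]
  push_cast
  congr 3
  refine Finset.filter_congr fun s _ => ⟨fun h => h.2, fun h => ⟨h ▸ hj, h⟩⟩

theorem hitCount_zero (n : ℕ) : hitCount 0 n = 1 := by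
  simpa using (succ_pow_eq_sum_hitCount 0 n).symm

theorem proposition3p4 (k m n : ℕ) :
    (lonesumD k m n : ℚ) =
      (-1) ^ k / (k.factorial : ℚ) *
        (1 + ∑ i ∈ Finset.Icc 1 k, (k.choose i : ℚ) * (-1) ^ i *
          (multiPolyBernoulliStar (zerosThenNeg (i - 1) m) n).eval ((i : ℚ) - 1)) := by
  have h1 := congrArg (Nat.cast (R := ℚ)) (lonesumD_mul_factorial k m n)
  rw [sum_hitCount_eq] at h1
  have hk : (k.factorial : ℚ) ≠ 0 := by positivity
  -- The isolated 1 of the formula is the missing term i = 0: only j = 0 survives, and h(0,m) =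
  -- h(0,n) = 1.
  have h2 : (1 : ℚ) = k.choose 0 * (-1) ^ 0 * ∑ j ∈ range (m + 1),
      coeff j ((mk 1 : PowerSeries ℚ) ^ 0) * ((hitCount j m : ℚ) * hitCount j n) := by
    rw [Finset.sum_eq_single_of_mem 0 (by simp)]
    · simp [hitCount_zero]
    · intro j _ hj
      simp [coeff_one, hj]
  have h3 : ∀ i ∈ Finset.Icc 1 k, (k.choose i : ℚ) * (-1) ^ i *
      (multiPolyBernoulliStar (zerosThenNeg (i - 1) m) n).eval ((i : ℚ) - 1) =
      k.choose i * (-1) ^ i * ∑ j ∈ range (m + 1),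
        coeff j ((mk 1 : PowerSeries ℚ) ^ i) * ((hitCount j m : ℚ) * hitCount j n) := by
    intro i hi
    obtain ⟨d, rfl⟩ : ∃ d, i = d + 1 := ⟨i - 1, by have := (mem_Icc.1 hi).1; omega⟩
    rw [Nat.add_sub_cancel, Nat.cast_succ, add_sub_cancel_right,
      eval_multiPolyBernoulliStar_zerosThenNeg]
    simp only [mk_one_pow_eq_mk_choose_add, coeff_mk]
  have h4 : 1 + ∑ i ∈ Finset.Icc 1 k, (k.choose i : ℚ) * (-1) ^ i *
      (multiPolyBernoulliStar (zerosThenNeg (i - 1) m) n).eval ((i : ℚ) - 1) =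
      ∑ i ∈ range (k + 1), k.choose i * (-1) ^ i * ∑ j ∈ range (m + 1),
        coeff j ((mk 1 : PowerSeries ℚ) ^ i) * ((hitCount j m : ℚ) * hitCount j n) := by
    rw [Finset.sum_congr rfl h3, Finset.sum_range_succ', add_comm, ← h2, sum_Icc_one_eq]
  have h5 : ∀ j, coeff j (((mk 1 : PowerSeries ℚ) - 1) ^ k) = (-1) ^ k *
      ∑ i ∈ range (k + 1), k.choose i * (-1) ^ i * coeff j ((mk 1 : PowerSeries ℚ) ^ i) := by
    intro j
    have e : ((mk 1 : PowerSeries ℚ) - 1) ^ k = PowerSeries.C ((-1 : ℚ) ^ k) *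
        ∑ i ∈ range (k + 1), PowerSeries.C ((k.choose i : ℚ) * (-1) ^ i) *
          (mk 1 : PowerSeries ℚ) ^ i := by
      rw [← neg_sub, neg_pow, sub_eq_neg_add, add_pow]
      simp only [map_pow, map_neg, map_one, map_mul, map_natCast]
      congr 1
      refine Finset.sum_congr rfl fun i _ => ?_
      rw [neg_pow, one_pow]
      ring
    rw [e, coeff_C_mul, map_sum]
    simp only [coeff_C_mul]
  rw [h4, eq_comm, div_mul_eq_mul_div, div_eq_iff hk, ← Nat.cast_mul, h1, Finset.mul_sum]
  simp only [h5, Finset.mul_sum, Finset.sum_mul]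
  rw [Finset.sum_comm]
  refine Finset.sum_congr rfl fun j _ => Finset.sum_congr rfl fun i _ => ?_
  ring
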